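/- Let $K$ be a number field with a fixed algebraic closure $\bar K$; for a positive integer $n$ let $\zeta_n\in\bar K$ denote a primitive $n$-th root of unity, and let $i=\zeta_4$. Write $\nu_p$ for the $p$-adic valuation. For an odd prime number $p$ put $$\epsilon_p=\gcd\{e_{\mathfrak p/p} : \mathfrak p \text{ a prime of } K,\ \mathfrak p\mid p\},$$ where $e_{\mathfrak p/p}$ is the ramification index, and call $p$ *distinguished* if $p-1\mid\epsilon_p$. Put also $$\epsilon_2=\gcd\{e_{\mathfrak p/(1+i)} : \mathfrak p \text{ a prime of } K(i),\ \mathfrak p\mid 1+i\},$$ the ramification indices being those over the prime $(1+i)$ of $\mathbb Q(i)$. **Proposition 5.1.** Let $\ell$ be a positive integer. 1. Let $p$ be an odd prime number and $m$ a positive integer not divisible by $p$. If $\zeta_p\in K(\zeta_m)$, then $p$ is distinguished. Moreover, if $\zeta_{p^\ell}\in K(\zeta_m)$, then $\ell\le\nu_p(\epsilon_p)+1$. 2. If $\zeta_{2^\ell}\in K(i,\zeta_m)$ for some odd positive integer $m$, then $\ell\le\nu_2(\epsilon_2)+3$. -/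

import Mathlib

open NumberField IntermediateField

/-- For a prime `p` of `A` and an extension `B` of `A`, the greatest common divisor of the
ramification indices `e(P/p)`, where `P` runs over all primes of `B` lying above `p`. -/
noncomputable def ramificationGcd {A : Type*} [CommRing A] (p : Ideal A)
    (B : Type*) [CommRing B] [Algebra A B] : ℕ :=
  Nat.setGcd ((fun P : Ideal B => P.ramificationIdx A) '' p.primesOver B)

/-- `ε_p` for a number field `K` and an odd prime `p`: the gcd of the ramification indices
over `p` of all primes of `K` above `p`. -/
noncomputable def epsilonOdd (K : Type*) [Field K] (p : ℕ) : ℕ :=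
  ramificationGcd (Ideal.span {(p : ℤ)}) (𝓞 K)

/-- An odd prime `p` is distinguished for `K` if `p - 1` divides `ε_p`. -/
def IsDistinguished (K : Type*) [Field K] (p : ℕ) : Prop :=
  p - 1 ∣ epsilonOdd K p

theorem isPrimitiveRoot_gen (F : Type*) {E : Type*} [Field F] [Field E] [Algebra F E] {i : E}
    {n : ℕ} (hi : IsPrimitiveRoot i n) : IsPrimitiveRoot (AdjoinSimple.gen F i) n :=
  IsPrimitiveRoot.of_map_of_injective (f := algebraMap F⟮i⟯ E)
    (by simpa using hi) (algebraMap F⟮i⟯ E).injective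

/-- The element `1 + i` of the ring of integers of `ℚ(i)`, where `i` is a primitive fourth root
of unity in a field `L` of characteristic zero and `ℚ(i)` is taken inside `L`. -/
noncomputable def oneAddI {L : Type*} [Field L] [CharZero L] {i : L} (hi : IsPrimitiveRoot i 4) :
    𝓞 ℚ⟮i⟯ :=
  1 + (isPrimitiveRoot_gen ℚ hi).toInteger

/-- `ε_2` for a number field `K`: the gcd of the ramification indices over `1 + i` (the prime of
`ℚ(i)` above `2`) of all primes of `K(i)` above `1 + i`. Here `i` is a primitive fourth root of
unity in an extension of `K`, and `ℚ(i)` is taken inside `K(i)`. -/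
noncomputable def epsilonTwo (K : Type*) {Ω : Type*} [Field K] [NumberField K] [Field Ω]
    [Algebra K Ω] {i : Ω} (hi : IsPrimitiveRoot i 4) : ℕ :=
  ramificationGcd (Ideal.span {oneAddI (isPrimitiveRoot_gen K hi)}) (𝓞 K⟮i⟯)

/-! A primitive `p ^ (k + 1)`-th root of unity in `K(ζ_m)` makes `(p)` a `φ(p ^ (k + 1))`-th power
of an ideal there. Since `p ∤ m`, the extension `K(ζ_m)/K` is unramified above `p`, so the exponents
of `(p)` are already those in `K`: each `e(P/p)`, hence their gcd, is divisible by `p ^ k * (p -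
1)`. For `p = 2` the same argument runs over `K(i)` with base prime `(1 + i)`; as `2` is `(1 + i) ^
2` up to a unit, the exponent is halved. The transfer from `K(ζ_m)` to `K` is
`dvd_ramificationGcd_of_map_eq_pow`. -/

/-- In a domain, `(ζ - 1) ^ φ(p ^ (k + 1))` is associated to `p` when `ζ` is a primitive
`p ^ (k + 1)`-th root of unity. -/
theorem IsPrimitiveRoot.associated_sub_one_pow_totient {R : Type*} [CommRing R] [IsDomain R]
    {p k : ℕ} [hp : Fact p.Prime] {ζ : R} (hζ : IsPrimitiveRoot ζ (p ^ (k + 1))) :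
    Associated ((ζ - 1) ^ (p ^ (k + 1)).totient) (p : R) := by
  rw [← Polynomial.eval_one_cyclotomic_prime_pow (R := R) (p := p) k,
    Polynomial.cyclotomic_eq_prod_X_sub_primitiveRoots hζ, Polynomial.eval_prod]
  simp only [Polynomial.eval_sub, Polynomial.eval_X, Polynomial.eval_C]
  rw [← hζ.card_primitiveRoots, ← Finset.prod_const]
  refine Associated.prod _ _ _ fun η hη ↦ ?_
  have : NeZero (p ^ (k + 1)) := ⟨pow_ne_zero _ hp.out.ne_zero⟩
  obtain ⟨i, -, hi, rfl⟩ := hζ.isPrimitiveRoot_iff.mp (isPrimitiveRoot_of_mem_primitiveRoots hη)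
  simpa using (hζ.associated_sub_one_pow_sub_one_of_coprime hi).neg_right

/-- If `L = F(ζ)` with `ζ` an `m`-th root of unity, then a prime of `L` not dividing `m` is
unramified over `F`. -/
theorem isUnramifiedAt_of_pow_eq_one {F L : Type*} [Field F] [Field L] [NumberField F]
    [NumberField L] [Algebra F L] {m : ℕ} {ζ : 𝓞 L} (hζ : ζ ^ m = 1) (hm : m ≠ 0)
    (hgen : Algebra.adjoin F {(ζ : L)} = ⊤) (Q : Ideal (𝓞 L)) [Q.IsPrime] (hQ : (m : 𝓞 L) ∉ Q) :
    Algebra.IsUnramifiedAt (𝓞 F) Q := by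
  rw [← not_dvd_differentIdeal_iff, Ideal.dvd_iff_le]
  intro h
  have hd := h (aeval_derivative_mem_differentIdeal (𝓞 F) F L ζ hgen)
  obtain ⟨g, hg⟩ : minpoly (𝓞 F) ζ ∣ Polynomial.X ^ m - 1 :=
    minpoly.isIntegrallyClosed_dvd (Algebra.IsIntegral.isIntegral ζ) (by simp [hζ])
  -- Differentiating `X ^ m - 1 = f * g` at `ζ`, with `f` the minimal polynomial, shows that `f'(ζ)`
  -- divides `m * ζ ^ (m - 1)`.
  have key := congrArg (fun f ↦ Polynomial.aeval ζ (Polynomial.derivative f)) hg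
  simp only [Polynomial.derivative_mul, map_add, map_mul, minpoly.aeval, zero_mul, add_zero,
    Polynomial.derivative_sub, Polynomial.derivative_X_pow, Polynomial.derivative_one, sub_zero,
    map_pow, Polynomial.aeval_X, map_natCast] at key
  have hmem : (m : 𝓞 L) * ζ ^ (m - 1) ∈ Q := key ▸ Q.mul_mem_right _ hd
  have := Q.mul_mem_right ζ hmem
  rw [mul_assoc, pow_sub_one_mul hm, hζ, mul_one] at this
  exact hQ this

/-- Suppose that `L = F(ζ)` with `ζ` an `m`-th root of unity, and that an ideal `p` becomes a
`k`-th power in `L`. Then `k` divides the ramification index over `p` of every prime of `F` above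
`p` not dividing `m`. -/
theorem dvd_ramificationIdx_of_map_eq_pow {A F L : Type*} [CommRing A] [Field F] [Field L]
    [NumberField F] [NumberField L] [Algebra F L] [Algebra A (𝓞 F)] {m k : ℕ} {ζ : 𝓞 L}
    (hζ : ζ ^ m = 1) (hm : m ≠ 0) (hgen : Algebra.adjoin F {(ζ : L)} = ⊤)
    (p : Ideal A) (hp : p.map (algebraMap A (𝓞 F)) ≠ ⊥) {J : Ideal (𝓞 L)}
    (hJ : (p.map (algebraMap A (𝓞 F))).map (algebraMap (𝓞 F) (𝓞 L)) = J ^ k)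
    (P : Ideal (𝓞 F)) [P.IsPrime] [P.LiesOver p] (hP : (m : 𝓞 F) ∉ P) :
    k ∣ P.ramificationIdx A := by
  have hP0 : P ≠ ⊥ := ne_bot_of_le_ne_bot hp (Ideal.map_le_of_le_comap (P.over_def p).le)
  obtain ⟨Q, hQ, hQP⟩ := Ideal.nonempty_primesOver (S := 𝓞 L) P
  have hQ0 : Q ≠ ⊥ := Ideal.ne_bot_of_liesOver_of_ne_bot hP0 Q
  have hmQ : (m : 𝓞 L) ∉ Q := by
    rwa [Ideal.mem_of_liesOver Q P, map_natCast] at hP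
  have := isUnramifiedAt_of_pow_eq_one hζ hm hgen Q hmQ
  have he := Ideal.IsDedekindDomain.emultiplicity_map_eq_ramificationIdx'_mul hp
    (Ideal.prime_of_isPrime hP0 ‹_›).irreducible (Ideal.prime_of_isPrime hQ0 ‹_›).irreducible
    hQ0 (v := P) (w := Q)
  have hQprime := Ideal.prime_of_isPrime hQ0 ‹_›
  have hPprime := Ideal.prime_of_isPrime hP0 ‹_›
  rw [Ideal.ramificationIdx'_eq_ramificationIdx P Q hP0,
    Ideal.ramificationIdx_eq_one_of_isUnramifiedAt, Nat.cast_one, one_mul, hJ,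
    emultiplicity_pow hQprime, (FiniteMultiplicity.of_prime_left hPprime hp).emultiplicity_eq_multiplicity,
    ← Ideal.IsDedekindDomain.ramificationIdx_eq_multiplicity p P hp] at he
  -- For `k = 0` the ideal `J` may be zero, with infinite multiplicity at `Q`.
  rcases eq_or_ne k 0 with rfl | hk
  · rw [Nat.cast_zero, zero_mul] at he
    exact (Nat.cast_injective he : 0 = _) ▸ dvd_rfl
  · have hfin : FiniteMultiplicity Q J := by
      rw [finiteMultiplicity_iff_emultiplicity_ne_top]
      intro htop
      rw [htop, ENat.mul_top (by exact_mod_cast hk)] at he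
      exact ENat.natCast_ne_top _ he.symm
    rw [hfin.emultiplicity_eq_multiplicity] at he
    exact ⟨_, by exact_mod_cast he.symm⟩

/-- Needed because `padicValNat` takes the junk value `0` at `0`, while every `k` divides `0`. -/
theorem ramificationGcd_ne_zero {A B : Type*} [CommRing A] [CommRing B] [Algebra A B]
    [Module.Finite A B] {p : Ideal A} (h : (p.primesOver B).Nonempty) :
    ramificationGcd p B ≠ 0 := by
  obtain ⟨P, hP⟩ := h
  have := hP.1
  rw [ramificationGcd, Ne, Nat.setGcd_eq_zero_iff]
  exact fun h ↦ (P.ramificationIdx_pos A).ne' (h ⟨P, hP, rfl⟩)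

theorem adjoin_gen_eq_top {F Ω : Type*} [Field F] [Field Ω] [Algebra F Ω] {x : Ω}
    (hx : IsIntegral F x) : Algebra.adjoin F {AdjoinSimple.gen F x} = ⊤ := by
  rw [← adjoin.powerBasis_gen hx]
  exact (adjoin.powerBasis hx).adjoin_gen_eq_top

/-- Suppose that `p` becomes a `k`-th power in `F(ζ)`, where `ζ` is a primitive `m`-th root of
unity with `m` prime to `p`. Then `k` divides the gcd of the ramification indices over `p` in
`F`. -/
theorem dvd_ramificationGcd_of_map_eq_pow {A F Ω : Type*} [CommRing A] [Field F] [NumberField F]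
    [Field Ω] [Algebra F Ω] [Algebra A (𝓞 F)] {m k q : ℕ} {ζ : Ω} (hζ : IsPrimitiveRoot ζ m)
    (hm : m ≠ 0) [NumberField F⟮ζ⟯] (hqm : q.Coprime m) (p : Ideal A) (hq : (q : A) ∈ p)
    (hp : p.map (algebraMap A (𝓞 F)) ≠ ⊥) {J : Ideal (𝓞 F⟮ζ⟯)}
    (hJ : (p.map (algebraMap A (𝓞 F))).map (algebraMap (𝓞 F) (𝓞 F⟮ζ⟯)) = J ^ k) :
    k ∣ ramificationGcd p (𝓞 F) := by
  rw [ramificationGcd, Nat.dvd_setGcd_iff]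
  rintro _ ⟨P, ⟨hP, hPp⟩, rfl⟩
  have : NeZero m := ⟨hm⟩
  have hgen := isPrimitiveRoot_gen F hζ
  refine dvd_ramificationIdx_of_map_eq_pow (ζ := hgen.toInteger)
    (hgen.toInteger_isPrimitiveRoot.pow_eq_one) hm
    (adjoin_gen_eq_top (hζ.isIntegral hm.bot_lt).tower_top) p hp hJ P fun hmP ↦ ?_
  have hqP : (q : 𝓞 F) ∈ P := by
    rwa [Ideal.mem_of_liesOver P p, map_natCast] at hq
  have hco := (Nat.isCoprime_iff_coprime.mpr hqm).map (Int.castRingHom (𝓞 F))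
  obtain ⟨a, b, hab⟩ := hco
  refine hP.ne_top ((Ideal.eq_top_iff_one _).mpr (hab ▸ ?_))
  simpa using P.add_mem (P.mul_mem_left a hqP) (P.mul_mem_left b hmP)

theorem epsilonOdd_ne_zero (K : Type*) [Field K] [NumberField K] (p : ℕ) [Fact p.Prime] :
    epsilonOdd K p ≠ 0 := by
  have : (Ideal.span {(p : ℤ)}).IsPrime :=
    (Ideal.span_singleton_prime (by simp [(Fact.out : p.Prime).ne_zero])).mpr
      (Nat.prime_iff_prime_int.mp Fact.out)
  exact ramificationGcd_ne_zero (Set.nonempty_coe_sort.mp (Ideal.nonempty_primesOver _))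

theorem numberField_adjoin_of_isPrimitiveRoot {K Ω : Type*} [Field K] [NumberField K] [Field Ω]
    [Algebra K Ω] {m : ℕ} (hm : m ≠ 0) {ζ : Ω} (hζ : IsPrimitiveRoot ζ m) : NumberField K⟮ζ⟯ := by
  have : FiniteDimensional K K⟮ζ⟯ :=
    adjoin.finiteDimensional (hζ.isIntegral hm.bot_lt).tower_top
  exact NumberField.of_module_finite K _

theorem pow_mul_sub_one_dvd_epsilonOdd {K Ω : Type*} [Field K] [NumberField K] [Field Ω]
    [Algebra K Ω] {p k m : ℕ} [hp : Fact p.Prime] (hpm : ¬ p ∣ m) {ζm ζ : Ω}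
    (hζm : IsPrimitiveRoot ζm m) (hζ : IsPrimitiveRoot ζ (p ^ (k + 1))) (hmem : ζ ∈ K⟮ζm⟯) :
    p ^ k * (p - 1) ∣ epsilonOdd K p := by
  have hm : m ≠ 0 := by rintro rfl; exact hpm (dvd_zero p)
  have := numberField_adjoin_of_isPrimitiveRoot (K := K) hm hζm
  have : NeZero (p ^ (k + 1)) := ⟨pow_ne_zero _ hp.out.ne_zero⟩
  have hζ' : IsPrimitiveRoot (⟨ζ, hmem⟩ : K⟮ζm⟯) (p ^ (k + 1)) :=
    IsPrimitiveRoot.of_map_of_injective (f := algebraMap K⟮ζm⟯ Ω) hζ (algebraMap K⟮ζm⟯ Ω).injective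
  have hassoc := hζ'.toInteger_isPrimitiveRoot.associated_sub_one_pow_totient
  rw [← Nat.totient_prime_pow_succ hp.out]
  refine dvd_ramificationGcd_of_map_eq_pow hζm hm ((Nat.Prime.coprime_iff_not_dvd hp.out).mpr hpm)
    _ (Ideal.mem_span_singleton_self _) ?_ (J := Ideal.span {hζ'.toInteger - 1}) ?_
  · simp [Ideal.map_span, hp.out.ne_zero]
  · rw [Ideal.span_singleton_pow, Ideal.span_singleton_eq_span_singleton.mpr hassoc]
    simp [Ideal.map_span]

theorem oneAddI_sq {L : Type*} [Field L] [CharZero L] {i : L} (hi : IsPrimitiveRoot i 4) :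
    oneAddI hi ^ 2 = 2 * (isPrimitiveRoot_gen ℚ hi).toInteger := by
  have h := (isPrimitiveRoot_gen ℚ hi).toInteger_isPrimitiveRoot
  have h2 : (isPrimitiveRoot_gen ℚ hi).toInteger ^ 2 = -1 :=
    (h.pow (by norm_num) (by norm_num : 4 = 2 * 2)).eq_neg_one_of_two_right
  rw [oneAddI, add_sq, h2]
  ring

theorem associated_oneAddI_sq {L : Type*} [Field L] [CharZero L] {i : L}
    (hi : IsPrimitiveRoot i 4) : Associated (oneAddI hi ^ 2) 2 := by
  rw [oneAddI_sq]
  exact associated_mul_unit_left _ _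
    ((isPrimitiveRoot_gen ℚ hi).toInteger_isPrimitiveRoot.isUnit (by norm_num))

/-- Holds because `1 + i = -i * (i - 1)`, and `ζ - 1` is prime for `ζ` of prime power order.
Primality ensures that some prime of `K(i)` lies above. -/
theorem span_oneAddI_isPrime {L : Type*} [Field L] [NumberField L] {i : L}
    (hi : IsPrimitiveRoot i 4) : (Ideal.span {oneAddI hi}).IsPrime := by
  have hgen : IsPrimitiveRoot (AdjoinSimple.gen ℚ i) (2 ^ (1 + 1)) := isPrimitiveRoot_gen ℚ hi
  have : IsCyclotomicExtension {2 ^ (1 + 1)} ℚ ℚ⟮i⟯ :=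
    IsPrimitiveRoot.intermediateField_adjoin_isCyclotomicExtension ℚ hi
  have : NumberField ℚ⟮i⟯ := IsCyclotomicExtension.numberField {2 ^ (1 + 1)} ℚ _
  have hprime := hgen.zeta_sub_one_prime
  have hinv : -hgen.toInteger * hgen.toInteger = 1 := by
    have h2 : hgen.toInteger ^ 2 = -1 :=
      (hgen.toInteger_isPrimitiveRoot.pow (by norm_num)
        (by norm_num : 2 ^ (1 + 1) = 2 * 2)).eq_neg_one_of_two_right
    linear_combination -h2
  have h : oneAddI hi = -hgen.toInteger * (hgen.toInteger - 1) := by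
    change 1 + hgen.toInteger = _
    linear_combination -hinv
  rw [h, Ideal.span_singleton_mul_left_unit (IsUnit.of_mul_eq_one _ hinv)]
  exact (Ideal.span_singleton_prime hprime.ne_zero).mpr hprime

theorem two_pow_dvd_epsilonTwo {K Ω : Type*} [Field K] [NumberField K] [Field Ω]
    [Algebra K Ω] {k m : ℕ} (hm : Odd m) {i ζm ζ : Ω} (hi : IsPrimitiveRoot i 4)
    (hζm : IsPrimitiveRoot ζm m) (hζ : IsPrimitiveRoot ζ (2 ^ (k + 2))) (hmem : ζ ∈ K⟮i, ζm⟯) :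
    2 ^ k ∣ epsilonTwo K hi := by
  have hm0 : m ≠ 0 := hm.pos.ne'
  have := numberField_adjoin_of_isPrimitiveRoot (K := K) (by norm_num) hi
  have := numberField_adjoin_of_isPrimitiveRoot (K := K⟮i⟯) hm0 hζm
  have hmem' : ζ ∈ K⟮i⟯⟮ζm⟯ := by
    rwa [← adjoin_simple_adjoin_simple, mem_restrictScalars] at hmem
  have : NeZero (2 ^ (k + 1 + 1)) := ⟨by positivity⟩
  have hζ' : IsPrimitiveRoot (⟨ζ, hmem'⟩ : K⟮i⟯⟮ζm⟯) (2 ^ (k + 1 + 1)) :=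
    IsPrimitiveRoot.of_map_of_injective (f := algebraMap K⟮i⟯⟮ζm⟯ Ω) hζ
      (algebraMap K⟮i⟯⟮ζm⟯ Ω).injective
  have hassoc := hζ'.toInteger_isPrimitiveRoot.associated_sub_one_pow_totient
  have h2 := associated_oneAddI_sq (isPrimitiveRoot_gen K hi)
  have h2' := h2.map (algebraMap (𝓞 ℚ⟮AdjoinSimple.gen K i⟯) (𝓞 K⟮i⟯))
  rw [map_pow, map_ofNat] at h2'
  have h2'' := h2'.map (algebraMap (𝓞 K⟮i⟯) (𝓞 K⟮i⟯⟮ζm⟯))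
  rw [map_pow, map_ofNat] at h2''
  refine dvd_ramificationGcd_of_map_eq_pow (q := 2) hζm hm0 (Nat.coprime_two_left.mpr hm)
    _ ?_ ?_ (J := Ideal.span {hζ'.toInteger - 1}) ?_
  · rw [Ideal.mem_span_singleton]
    exact (dvd_pow_self _ two_ne_zero).trans h2.dvd
  · rw [Ideal.map_span, Set.image_singleton, Ne, Ideal.span_singleton_eq_bot]
    intro h0
    rw [h0, zero_pow two_ne_zero, Associated.comm, associated_zero_iff_eq_zero] at h2'
    exact two_ne_zero h2'
  · rw [Ideal.map_span, Set.image_singleton, Ideal.map_span, Set.image_singleton,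
      Ideal.span_singleton_pow, Ideal.span_singleton_eq_span_singleton,
      -- Squaring both sides reduces the claim to `(1 + i) ^ 2 ~ 2 ~ (ζ - 1) ^ (2 ^ (k + 1))`.
      ← Associated.pow_iff two_ne_zero]
    refine h2''.trans ?_
    rw [← pow_mul, ← pow_succ]
    simpa [Nat.totient_prime_pow_succ Nat.prime_two] using hassoc.symm

theorem epsilonTwo_ne_zero {K Ω : Type*} [Field K] [NumberField K] [Field Ω] [Algebra K Ω] {i : Ω}
    (hi : IsPrimitiveRoot i 4) : epsilonTwo K hi ≠ 0 := by
  have := numberField_adjoin_of_isPrimitiveRoot (K := K) (by norm_num) hi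
  have := span_oneAddI_isPrime (isPrimitiveRoot_gen K hi)
  exact ramificationGcd_ne_zero (Set.nonempty_coe_sort.mp (Ideal.nonempty_primesOver _))

theorem proposition5p1 {K Ω : Type*} [Field K] [NumberField K] [Field Ω] [Algebra K Ω]
    [IsAlgClosure K Ω] (ℓ : ℕ) (hℓ : 0 < ℓ) :
    (∀ p : ℕ, p.Prime → Odd p → ∀ m : ℕ, ¬ p ∣ m → ∀ ζm : Ω, IsPrimitiveRoot ζm m →
      (∀ ζ : Ω, IsPrimitiveRoot ζ p → ζ ∈ K⟮ζm⟯ → IsDistinguished K p) ∧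
      (∀ ζ : Ω, IsPrimitiveRoot ζ (p ^ ℓ) → ζ ∈ K⟮ζm⟯ →
        ℓ ≤ padicValNat p (epsilonOdd K p) + 1)) ∧
    (∀ m : ℕ, Odd m → ∀ (i : Ω) (hi : IsPrimitiveRoot i 4) (ζm : Ω), IsPrimitiveRoot ζm m →
      ∀ ζ : Ω, IsPrimitiveRoot ζ (2 ^ ℓ) → ζ ∈ K⟮i, ζm⟯ →
        ℓ ≤ padicValNat 2 (epsilonTwo K hi) + 3) := by
  refine ⟨fun p hp _ m hpm ζm hζm ↦ ⟨fun ζ hζ hmem ↦ ?_, fun ζ hζ hmem ↦ ?_⟩,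
    fun m hm i hi ζm hζm ζ hζ hmem ↦ ?_⟩
  · have : Fact p.Prime := ⟨hp⟩
    simpa [IsDistinguished] using pow_mul_sub_one_dvd_epsilonOdd (k := 0) hpm hζm (by simpa using hζ) hmem
  · have : Fact p.Prime := ⟨hp⟩
    obtain ⟨k, rfl⟩ := Nat.exists_eq_add_one.mpr hℓ
    have h := (Dvd.intro _ rfl).trans (pow_mul_sub_one_dvd_epsilonOdd hpm hζm hζ hmem)
    rw [padicValNat_dvd_iff_le (epsilonOdd_ne_zero K p)] at h
    omega
  · rcases lt_or_ge ℓ 2 with h2 | h2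
    · omega
    obtain ⟨k, rfl⟩ := Nat.exists_eq_add_of_le' h2
    have h := two_pow_dvd_epsilonTwo hm hi hζm hζ hmem
    rw [padicValNat_dvd_iff_le (epsilonTwo_ne_zero hi)] at h
    -- Here `k ≤ ν₂(ε₂)` and `ℓ = k + 2`, so this case even gives `ℓ ≤ ν₂(ε₂) + 2`.
    omega
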